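/- Let the power beacons $\Phi=\{x_k\}_{k\ge 1}$ form a homogeneous Poisson point process of intensity $\lambda>0$ on $\mathbb{R}^2$. Let the links from the beacons to an energy harvesting node at the origin undergo IID Rayleigh fading with coefficients $h_k$, independent of $\Phi$, so that the gains $H_k=|h_k|^2$ are IID exponential random variables of mean $1$. Let the path loss be bounded, $\ell(r,\eta)=\max(1,r^\eta)$ with $\eta>2$, let $P_{\rm PB}>0$ be the transmit power of a beacon and $\mu\in(0,1]$ the conversion efficiency. Then the per-slot harvested energy $$Z=P_{\rm PB}\,\mu\sum_{k}\frac{H_k}{\ell(\|x_k\|,\eta)}$$ is almost surely finite, and its Laplace transform $\mathcal{L}_Z(s)=\mathbb{E}[e^{-sZ}]$ is, for every $s\ge 0$, $$\mathcal{L}_Z(s)=\exp\left(-\pi\lambda\,\frac{P_{\rm PB}\mu s}{1+P_{\rm PB}\mu s}\right)\exp\left(-\pi\lambda\,\mathcal{F}(P_{\rm PB}\mu s,\eta)\right),$$ where, for $x\ge 0$ and $\eta>2$, $$\mathcal{F}(x,\eta)=\frac{2x}{\eta-2}\;{}_2F_1\left(1,\,1-\frac{2}{\eta};\,2-\frac{2}{\eta};\,-x\right)$$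 and ${}_2F_1(a,b;c;\cdot)$ is Gauss's hypergeometric function, i.e. the analytic continuation of the series $\sum_{n\ge 0}\frac{(a)_n(b)_n}{(c)_n}\frac{z^n}{n!}$ ($|z|<1$) to $\mathbb{C}\setminus[1,\infty)$. -/

import Mathlib

open MeasureTheory ProbabilityTheory
open scoped NNReal ENNReal

/-- The plane `ℝ²` with its Euclidean norm; `volume` on it is the Lebesgue measure. -/
abbrev Plane : Type := EuclideanSpace ℝ (Fin 2)

section Hypergeometric

/-- The plane cut along `[1, ∞)`, the domain of the principal branch of `₂F₁(a, b; c; ·)`. -/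
def cutPlane : Set ℂ := {z : ℂ | 1 - z ∈ Complex.slitPlane}

/-- `f` is analytic on `ℂ ∖ [1, ∞)` and is the sum of the Gauss series
`∑ (a)ₙ (b)ₙ / (c)ₙ zⁿ / n!` on the open unit disc. -/
def IsGaussContinuation (a b c : ℂ) (f : ℂ → ℂ) : Prop :=
  AnalyticOnNhd ℂ f cutPlane ∧
    ∀ z : ℂ, ‖z‖ < 1 → f z = ordinaryHypergeometric a b c z

open Classical in
/-- Gauss's hypergeometric function `₂F₁(a, b; c; z)` (principal branch): the analytic continuation
of the Gauss series from the unit disc to `ℂ ∖ [1, ∞)`. Mathlib's `ordinaryHypergeometric` is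
the bare sum of the series, which has the value `0` where the series diverges. -/
noncomputable def gaussHypergeometric (a b c z : ℂ) : ℂ :=
  if hf : ∃ f : ℂ → ℂ, IsGaussContinuation a b c f then Classical.choose hf z else 0

/-- The continuation is unique, so the choice in the definition is immaterial. -/
theorem gaussHypergeometric_eq {a b c : ℂ} {f : ℂ → ℂ} (hf : IsGaussContinuation a b c f)
    {z : ℂ} (hz : z ∈ cutPlane) : gaussHypergeometric a b c z = f z := by
  have hex : ∃ f : ℂ → ℂ, IsGaussContinuation a b c f := ⟨f, hf⟩
  rw [gaussHypergeometric, dif_pos hex]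
  have hg := Classical.choose_spec hex
  have hpre : IsPreconnected cutPlane := by
    have h1 : IsPreconnected Complex.slitPlane :=
      (Complex.starConvex_one_slitPlane.isPathConnected
        Complex.one_mem_slitPlane).isConnected.isPreconnected
    have h2 : cutPlane = (fun z : ℂ => 1 - z) '' Complex.slitPlane := by
      ext z
      constructor
      · intro hz
        exact ⟨1 - z, hz, by ring⟩
      · rintro ⟨w, hw, rfl⟩
        simpa [cutPlane] using hw
    rw [h2]
    exact h1.image _ (by fun_prop)
  refine AnalyticOnNhd.eqOn_of_preconnected_of_eventuallyEq hg.1 hf.1 hpre (z₀ := 0)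
    (by simp [cutPlane, Complex.one_mem_slitPlane]) ?_ hz
  filter_upwards [Metric.ball_mem_nhds (0 : ℂ) one_pos] with w hw
  have hw' : ‖w‖ < 1 := by simpa using hw
  rw [hg.2 w hw', hf.2 w hw']

/-- `𝓕(x, η) = (2x / (η - 2)) ₂F₁(1, 1 - 2/η; 2 - 2/η; -x)` for `x ≥ 0`, `η > 2`
(where the hypergeometric value is a real number). -/
noncomputable def functionF (x η : ℝ) : ℝ :=
  2 * x / (η - 2) *
    (gaussHypergeometric 1 ((1 - 2 / η : ℝ) : ℂ) ((2 - 2 / η : ℝ) : ℂ) ((-x : ℝ) : ℂ)).re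

end Hypergeometric

section Network

/-- The number of points (with multiplicity) of the configuration `{x_k}` that lie in `B`. -/
noncomputable def pointCount {Ω : Type*} (x : ℕ → Ω → Plane) (B : Set Plane) (ω : Ω) : ℕ∞ :=
  Set.encard {k : ℕ | x k ω ∈ B}

/-- `Φ = {x_k}` is a homogeneous Poisson point process on the plane of intensity `lam`: the number
of points in a Borel set of finite area is Poisson with mean `lam` times the area, and the numbers
of points in pairwise disjoint Borel sets are independent. -/
structure IsHomogeneousPPP {Ω : Type*} [MeasurableSpace Ω] (lam : ℝ≥0) (x : ℕ → Ω → Plane)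
    (P : Measure Ω) : Prop where
  measurable : ∀ k, Measurable (x k)
  poisson : ∀ B : Set Plane, MeasurableSet B → volume B ≠ ∞ → ∀ n : ℕ,
    P {ω | pointCount x B ω = n} = poissonMeasure (lam * (volume B).toNNReal) {n}
  indep : ∀ (n : ℕ) (B : Fin n → Set Plane), (∀ i, MeasurableSet (B i)) →
    Pairwise (fun i j => Disjoint (B i) (B j)) → iIndepFun (fun i => pointCount x (B i)) P

/-- The power gain `H_k = |h_k|²` of the link with fading coefficient `h_k`. -/
noncomputable def channelGain {Ω : Type*} (h : ℕ → Ω → ℂ) (k : ℕ) (ω : Ω) : ℝ := ‖h k ω‖ ^ 2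

/-- IID Rayleigh fading of unit mean power: the gains `|h_k|²` are independent and each of them is
exponentially distributed with rate `1`. -/
structure IsRayleighFading {Ω : Type*} [MeasurableSpace Ω] (h : ℕ → Ω → ℂ) (P : Measure Ω) :
    Prop where
  measurable : ∀ k, Measurable (h k)
  law : ∀ k, P.map (channelGain h k) = expMeasure 1
  indep : iIndepFun (channelGain h) P

/-- Bounded path loss `ℓ(r, η) = max(1, r^η)`. -/
noncomputable def pathLoss (r η : ℝ) : ℝ := max 1 (r ^ η)

/-- Per-slot energy `Z = P_PB μ ∑_k H_k / ℓ(‖x_k‖, η)` harvested at the origin. -/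
noncomputable def harvestedEnergy {Ω : Type*} (PPB mu η : ℝ) (x : ℕ → Ω → Plane)
    (h : ℕ → Ω → ℂ) (ω : Ω) : ℝ :=
  PPB * mu * ∑' k, channelGain h k ω / pathLoss ‖x k ω‖ η

/-- The Laplace transform `𝓛_Z(s) = 𝔼[exp(-s Z)]`. -/
noncomputable def laplaceTransform {Ω : Type*} [MeasurableSpace Ω] (Z : Ω → ℝ) (P : Measure Ω)
    (s : ℝ) : ℝ :=
  ∫ ω, Real.exp (-s * Z ω) ∂P

end Network

/-! Put `a = PPB * mu * s` and `c y = a / ℓ(‖y‖)`. With the locations frozen, a unit-mean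
exponential gain averages `exp (-c H)` to `(1 + c)⁻¹`, so the fading turns `exp (-s Z)` into `∏ (1 +
c (x k))⁻¹ = exp (-∑ log (1 + c (x k)))` (`integral_exp_neg_tsum_channelGain_mul`). The Laplace
functional of the Poisson process (`integral_exp_neg_tsum`), applied to `log (1 + c)`, gives `exp
(-λ ∫ c / (1 + c)) = exp (-λ ∫ a / (a + ℓ))`. In polar coordinates the unit disc contributes `π a /
(1 + a)` and its exterior `π ∫₁^∞ 2 r a / (a + r ^ η) dr` (`integral_div_add_pathLoss_norm`).

The exterior integral is `π 𝓕(a, η)`: the substitution `v = r ^ (2 - η)` makes it an Euler-type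
integral over `[0, 1]`, which is analytic on the cut plane and has the Gauss series on the disc
(`functionF_eq_integral`). Almost sure finiteness of `Z` follows from Campbell's formula, since `1 /
ℓ` is integrable on the plane exactly because `η > 2`. -/

section GaussIntegral

/-! ### The hypergeometric function as an Euler-type integral. -/

theorem isOpen_cutPlane : IsOpen cutPlane :=
  Complex.isOpen_slitPlane.preimage (f := fun z : ℂ => 1 - z) (by fun_prop)

/-- A zero would force `z = 1 / t ≥ 1`, which lies on the cut. -/
theorem one_sub_mul_ne_zero_of_mem_cutPlane {z : ℂ} (hz : z ∈ cutPlane) {t : ℝ} (h0 : 0 ≤ t)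
    (h1 : t ≤ 1) : 1 - z * (t : ℂ) ≠ 0 := by
  intro h
  have ht : t ≠ 0 := by
    rintro rfl
    simp at h
  have htpos : 0 < t := lt_of_le_of_ne h0 (Ne.symm ht)
  have hz' : z = ((t⁻¹ : ℝ) : ℂ) := by
    have : (t : ℂ) ≠ 0 := by exact_mod_cast ht
    push_cast
    field_simp
    linear_combination -h
  have hz2 : 1 - z = ((1 - t⁻¹ : ℝ) : ℂ) := by rw [hz']; push_cast; ring
  have h3 : 1 - z ∈ Complex.slitPlane := hz
  rw [hz2, Complex.ofReal_mem_slitPlane] at h3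
  have := (one_le_inv₀ htpos).2 h1
  linarith

/-- The Euler-type integral `∫₀¹ dv / (1 - z v^β)`. -/
noncomputable def eulerIntegral (β : ℝ) (z : ℂ) : ℂ :=
  ∫ v in (0 : ℝ)..1, (1 - z * ((v ^ β : ℝ) : ℂ))⁻¹

/-- Differentiation under the integral sign: the `z`-derivative of the integrand is continuous on
the compact set (closed disc) × `[0, 1]`, so a constant dominates it. -/
theorem differentiableAt_eulerIntegral {β : ℝ} (hβ : 0 < β) {z₀ : ℂ} (hz₀ : z₀ ∈ cutPlane) :
    DifferentiableAt ℂ (eulerIntegral β) z₀ := by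
  obtain ⟨ε, hε, hsub⟩ := Metric.nhds_basis_closedBall.mem_iff.1 (isOpen_cutPlane.mem_nhds hz₀)
  have hmem : ∀ v ∈ Set.Icc (0 : ℝ) 1, v ^ β ∈ Set.Icc (0 : ℝ) 1 := fun v hv =>
    ⟨Real.rpow_nonneg hv.1 _, Real.rpow_le_one hv.1 hv.2 hβ.le⟩
  have hcont : Continuous fun v : ℝ => ((v ^ β : ℝ) : ℂ) :=
    Complex.continuous_ofReal.comp (Real.continuous_rpow_const hβ.le)
  have hK : IsCompact (Metric.closedBall z₀ ε ×ˢ Set.Icc (0 : ℝ) 1) :=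
    (isCompact_closedBall z₀ ε).prod isCompact_Icc
  have hne : ∀ z ∈ Metric.closedBall z₀ ε, ∀ v ∈ Set.Icc (0 : ℝ) 1,
      1 - z * ((v ^ β : ℝ) : ℂ) ≠ 0 := fun z hz v hv =>
    one_sub_mul_ne_zero_of_mem_cutPlane (hsub hz) (hmem v hv).1 (hmem v hv).2
  have hFc : ContinuousOn
      (fun p : ℂ × ℝ => ((p.2 ^ β : ℝ) : ℂ) / (1 - p.1 * ((p.2 ^ β : ℝ) : ℂ)) ^ 2)
      (Metric.closedBall z₀ ε ×ˢ Set.Icc (0 : ℝ) 1) := by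
    have h2 : Continuous fun p : ℂ × ℝ => ((p.2 ^ β : ℝ) : ℂ) := hcont.comp continuous_snd
    refine h2.continuousOn.div (by fun_prop) fun p hp => pow_ne_zero _ (hne _ hp.1 _ hp.2)
  obtain ⟨C, hC⟩ := hK.exists_bound_of_continuousOn hFc
  have hIoc : ∀ v ∈ Set.uIoc (0 : ℝ) 1, v ∈ Set.Icc (0 : ℝ) 1 := fun v hv => by
    rw [Set.uIoc_of_le zero_le_one] at hv
    exact Set.Ioc_subset_Icc_self hv
  have hF : ∀ z ∈ Metric.closedBall z₀ ε,
      ContinuousOn (fun v : ℝ => (1 - z * ((v ^ β : ℝ) : ℂ))⁻¹) (Set.Icc 0 1) := fun z hz =>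
    (continuous_const.sub (continuous_const.mul hcont)).continuousOn.inv₀ (hne z hz)
  refine (intervalIntegral.hasDerivAt_integral_of_dominated_loc_of_deriv_le
    (F := fun z v => (1 - z * ((v ^ β : ℝ) : ℂ))⁻¹)
    (F' := fun z v => ((v ^ β : ℝ) : ℂ) / (1 - z * ((v ^ β : ℝ) : ℂ)) ^ 2)
    (bound := fun _ => C) (Metric.closedBall_mem_nhds z₀ hε) ?_ ?_ ?_ ?_ ?_ ?_).2.differentiableAt
  · filter_upwards [Metric.closedBall_mem_nhds z₀ hε] with z hz
    refine ((hF z hz).mono fun v hv => hIoc v hv).aestronglyMeasurable measurableSet_uIoc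
  · refine ContinuousOn.intervalIntegrable ?_
    rw [Set.uIcc_of_le zero_le_one]
    exact hF z₀ (Metric.mem_closedBall_self hε.le)
  · refine ContinuousOn.aestronglyMeasurable ?_ measurableSet_uIoc
    refine hcont.continuousOn.div
      ((continuous_const.sub (continuous_const.mul hcont)).pow 2).continuousOn fun v hv =>
      pow_ne_zero _ (hne _ (Metric.mem_closedBall_self hε.le) _ (hIoc v hv))
  · exact Filter.Eventually.of_forall fun v hv z hz => hC (z, v) ⟨hz, hIoc v hv⟩
  · exact intervalIntegrable_const
  · refine Filter.Eventually.of_forall fun v hv z hz => ?_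
    have h1 : HasDerivAt (fun z : ℂ => 1 - z * ((v ^ β : ℝ) : ℂ)) (-((v ^ β : ℝ) : ℂ)) z := by
      simpa using ((hasDerivAt_id z).mul_const ((v ^ β : ℝ) : ℂ)).const_sub 1
    have h2 := h1.inv (hne z hz v (hIoc v hv))
    rw [neg_neg] at h2
    exact h2

/-- Expand the integrand as a geometric series dominated by `‖z‖ ^ n` and integrate `v ^ (β n)` term
by term. -/
theorem hasSum_eulerIntegral {β : ℝ} (hβ : 0 < β) {z : ℂ} (hz : ‖z‖ < 1) :
    HasSum (fun n : ℕ => z ^ n / ((β * n + 1 : ℝ) : ℂ)) (eulerIntegral β z) := by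
  have hcont : Continuous fun v : ℝ => ((v ^ β : ℝ) : ℂ) :=
    Complex.continuous_ofReal.comp (Real.continuous_rpow_const hβ.le)
  have hnorm : ∀ v ∈ Set.uIoc (0 : ℝ) 1, ‖z * ((v ^ β : ℝ) : ℂ)‖ ≤ ‖z‖ := fun v hv => by
    rw [Set.uIoc_of_le zero_le_one] at hv
    rw [norm_mul, Complex.norm_real, Real.norm_of_nonneg (Real.rpow_nonneg hv.1.le _)]
    exact mul_le_of_le_one_right (norm_nonneg _) (Real.rpow_le_one hv.1.le hv.2 hβ.le)
  have key := intervalIntegral.hasSum_integral_of_dominated_convergence (a := (0 : ℝ)) (b := 1)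
    (μ := volume) (F := fun (n : ℕ) v => (z * ((v ^ β : ℝ) : ℂ)) ^ n)
    (f := fun v => (1 - z * ((v ^ β : ℝ) : ℂ))⁻¹) (bound := fun n _ => ‖z‖ ^ n)
    (fun n => (by fun_prop : Continuous _).aestronglyMeasurable)
    (fun n => Filter.Eventually.of_forall fun v hv => by
      rw [norm_pow]; exact pow_le_pow_left₀ (norm_nonneg _) (hnorm v hv) n)
    (Filter.Eventually.of_forall fun _ _ => summable_geometric_of_lt_one (norm_nonneg _) hz)
    intervalIntegrable_const
    (Filter.Eventually.of_forall fun v hv =>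
      hasSum_geometric_of_norm_lt_one ((hnorm v hv).trans_lt hz))
  have hterm : ∀ n : ℕ, ∫ v in (0 : ℝ)..1, (z * ((v ^ β : ℝ) : ℂ)) ^ n =
      z ^ n / ((β * n + 1 : ℝ) : ℂ) := fun n => by
    have h1 : ∀ v ∈ Set.uIcc (0 : ℝ) 1,
        (z * ((v ^ β : ℝ) : ℂ)) ^ n = z ^ n * ((v ^ (β * n) : ℝ) : ℂ) := fun v hv => by
      rw [Set.uIcc_of_le zero_le_one] at hv
      rw [mul_pow, Real.rpow_mul hv.1, Real.rpow_natCast]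
      push_cast
      ring
    have hpos : 0 < β * n + 1 := by positivity
    rw [intervalIntegral.integral_congr h1, intervalIntegral.integral_const_mul,
      intervalIntegral.integral_ofReal, integral_rpow (Or.inl (by linarith)), Real.one_rpow,
      Real.zero_rpow hpos.ne', sub_zero, one_div, Complex.ofReal_inv,
      div_eq_mul_inv]
  simp only [hterm] at key
  exact key

/-- Both sides are the rising factorial `(b)ₙ₊₁`. Hence `(b)ₙ / (b + 1)ₙ = b / (b + n)`, which is `1
/ (β n + 1)` for `b = β⁻¹`. -/
theorem ascPochhammer_eval_mul_add {b : ℂ} (n : ℕ) :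
    (ascPochhammer ℂ n).eval b * (b + n) = b * (ascPochhammer ℂ n).eval (b + 1) := by
  induction n with
  | zero => simp
  | succ n ih =>
    rw [ascPochhammer_succ_eval, ascPochhammer_succ_eval]
    push_cast
    linear_combination (b + 1 + n) * ih

theorem isGaussContinuation_eulerIntegral {β : ℝ} (hβ : 0 < β) :
    IsGaussContinuation 1 ((β⁻¹ : ℝ) : ℂ) ((β⁻¹ + 1 : ℝ) : ℂ) (eulerIntegral β) := by
  constructor
  · refine DifferentiableOn.analyticOnNhd (fun z hz =>
      (differentiableAt_eulerIntegral hβ hz).differentiableWithinAt) isOpen_cutPlane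
  · intro z hz
    rw [ordinaryHypergeometric_eq_tsum, ← (hasSum_eulerIntegral hβ hz).tsum_eq]
    refine tsum_congr fun n => ?_
    have hb : (β : ℂ) ≠ 0 := by exact_mod_cast hβ.ne'
    have hpos : (β * n + 1 : ℂ) ≠ 0 := by
      have : 0 < β * n + 1 := by positivity
      exact_mod_cast this.ne'
    have hp : (ascPochhammer ℂ n).eval ((β⁻¹ + 1 : ℝ) : ℂ) ≠ 0 := by
      have := ascPochhammer_pos n (β⁻¹ + 1) (by positivity)
      rw [← ascPochhammer_map (algebraMap ℝ ℂ)]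
      have h2 := Polynomial.eval_map_algebraMap (B := ℂ) (ascPochhammer ℝ n) ((β⁻¹ + 1 : ℝ) : ℂ)
      rw [h2]
      have h3 := Polynomial.aeval_algebraMap_apply ℂ (β⁻¹ + 1) (ascPochhammer ℝ n)
      simp only [Complex.coe_algebraMap] at h3
      rw [h3]
      simpa using this.ne'
    have h1 := ascPochhammer_eval_mul_add (b := ((β⁻¹ : ℝ) : ℂ)) n
    have hf : (n.factorial : ℂ) ≠ 0 := by exact_mod_cast n.factorial_ne_zero
    rw [ascPochhammer_eval_one, smul_eq_mul, inv_mul_cancel₀ hf, one_mul]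
    have hshift : ((β⁻¹ : ℝ) : ℂ) + 1 = ((β⁻¹ + 1 : ℝ) : ℂ) := by push_cast; ring
    rw [hshift] at h1
    generalize (ascPochhammer ℂ n).eval ((β⁻¹ + 1 : ℝ) : ℂ) = q at h1 hp ⊢
    generalize (ascPochhammer ℂ n).eval ((β⁻¹ : ℝ) : ℂ) = p at h1 ⊢
    push_cast at h1 ⊢
    field_simp at h1 ⊢
    linear_combination -z ^ n * h1

theorem gaussHypergeometric_eq_eulerIntegral {β : ℝ} (hβ : 0 < β) {z : ℂ} (hz : z ∈ cutPlane) :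
    gaussHypergeometric 1 ((β⁻¹ : ℝ) : ℂ) ((β⁻¹ + 1 : ℝ) : ℂ) z = eulerIntegral β z :=
  gaussHypergeometric_eq (isGaussContinuation_eulerIntegral hβ) hz

theorem eulerIntegral_neg_ofReal (β x : ℝ) :
    eulerIntegral β ((-x : ℝ) : ℂ) = ((∫ v in (0 : ℝ)..1, (1 + x * v ^ β)⁻¹ : ℝ) : ℂ) := by
  rw [eulerIntegral, ← intervalIntegral.integral_ofReal]
  congr 1
  ext v
  push_cast
  ring

/-- With `β = η / (η - 2)` and `v = r ^ (2 - η)` one has `v ^ β = r ^ (-η)`; the Jacobian supplies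
the factor `η - 2` that cancels the denominator of `functionF`. -/
theorem functionF_eq_integral {x η : ℝ} (hx : 0 ≤ x) (hη : 2 < η) :
    functionF x η = ∫ r in Set.Ioi (1 : ℝ), 2 * r * (x / (x + r ^ η)) := by
  have hβ : 0 < η / (η - 2) := div_pos (by linarith) (by linarith)
  have hη2 : η - 2 ≠ 0 := by linarith
  have hη0 : η ≠ 0 := by linarith
  have e1 : (1 - 2 / η : ℝ) = (η / (η - 2))⁻¹ := by field_simp
  have e2 : (2 - 2 / η : ℝ) = (η / (η - 2))⁻¹ + 1 := by rw [← e1]; ring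
  have hz : ((-x : ℝ) : ℂ) ∈ cutPlane := by
    have : (1 : ℂ) - ((-x : ℝ) : ℂ) = ((1 + x : ℝ) : ℂ) := by push_cast; ring
    change (1 : ℂ) - ((-x : ℝ) : ℂ) ∈ Complex.slitPlane
    rw [this, Complex.ofReal_mem_slitPlane]
    linarith
  rw [functionF, e1, e2, gaussHypergeometric_eq_eulerIntegral hβ hz, eulerIntegral_neg_ofReal,
    Complex.ofReal_re, intervalIntegral.integral_of_le zero_le_one, integral_Ioc_eq_integral_Ioo]
  have himg : (fun r : ℝ => r ^ (2 - η)) '' Set.Ioi 1 = Set.Ioo 0 1 := by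
    ext v
    constructor
    · rintro ⟨r, hr, rfl⟩
      have hr : 1 < r := hr
      exact ⟨Real.rpow_pos_of_pos (by linarith) _,
        Real.rpow_lt_one_of_one_lt_of_neg hr (by linarith)⟩
    · rintro ⟨hv0, hv1⟩
      refine ⟨v ^ (2 - η)⁻¹, ?_, ?_⟩
      · exact Real.one_lt_rpow_of_pos_of_lt_one_of_neg hv0 hv1 (inv_lt_zero.2 (by linarith))
      · exact Real.rpow_inv_rpow hv0.le (by linarith)
  have hinj : Set.InjOn (fun r : ℝ => r ^ (2 - η)) (Set.Ioi 1) := by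
    intro r hr s hs h
    have hr : 1 < r := hr
    have hs : 1 < s := hs
    exact (Real.rpow_left_injOn (x := 2 - η) (by linarith)) (by simp; linarith) (by simp; linarith) h
  rw [← himg, integral_image_eq_integral_abs_deriv_smul measurableSet_Ioi
    (f' := fun r => (2 - η) * r ^ (2 - η - 1)) (fun r hr => ?_) hinj, ← integral_const_mul]
  · refine setIntegral_congr_fun measurableSet_Ioi fun r hr => ?_
    have hr : 1 < r := hr
    have hr0 : 0 < r := by linarith
    have hrη : 0 < r ^ η := Real.rpow_pos_of_pos hr0 _
    have a1 : (r ^ (2 - η)) ^ (η / (η - 2)) = (r ^ η)⁻¹ := by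
      rw [← Real.rpow_mul hr0.le, ← Real.rpow_neg hr0.le]
      congr 1
      field_simp
      ring
    have a2 : |(2 - η) * r ^ (2 - η - 1)| = (η - 2) * (r / r ^ η) := by
      rw [abs_mul, abs_of_neg (by linarith), abs_of_pos (Real.rpow_pos_of_pos hr0 _),
        show 2 - η - 1 = 1 - η by ring, Real.rpow_sub hr0, Real.rpow_one]
      ring
    have : 0 < x + r ^ η := by positivity
    simp only [smul_eq_mul]
    rw [a1, a2]
    field_simp
    ring
  · have hr : 1 < r := hr
    exact (Real.hasDerivAt_rpow_const (Or.inl (by linarith))).hasDerivWithinAt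

end GaussIntegral

/-! ### Generating function and mean of the Poisson law. -/

section Poisson

open Filter Topology

theorem hasSum_exp_neg_mul_poisson (r : ℝ≥0) (a : ℝ) :
    HasSum (fun n : ℕ => Real.exp (-r) * r ^ n / n.factorial * Real.exp (-a * n))
      (Real.exp (-r * (1 - Real.exp (-a)))) := by
  have h := (NormedSpace.expSeries_div_hasSum_exp ((r : ℝ) * Real.exp (-a))).mul_left
    (Real.exp (-r))
  rw [← Real.exp_eq_exp_ℝ, ← Real.exp_add] at h
  have hsum : (-r + r * Real.exp (-a) : ℝ) = -r * (1 - Real.exp (-a)) := by ring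
  rw [hsum] at h
  have hterm : ∀ n : ℕ, Real.exp (-r) * ((r * Real.exp (-a)) ^ n / n.factorial) =
      Real.exp (-r) * r ^ n / n.factorial * Real.exp (-a * n) := fun n => by
    rw [mul_pow, ← Real.exp_nat_mul, mul_comm (n : ℝ)]
    ring
  simpa only [hterm] using h

theorem integral_exp_neg_mul_poissonMeasure (r : ℝ≥0) (a : ℝ) :
    ∫ n : ℕ, Real.exp (-a * n) ∂(poissonMeasure r) = Real.exp (-r * (1 - Real.exp (-a))) := by
  rw [integral_poissonMeasure]
  exact (hasSum_exp_neg_mul_poisson r a).tsum_eq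

theorem lintegral_natCast_poissonMeasure (r : ℝ≥0) :
    ∫⁻ n : ℕ, (n : ℝ≥0∞) ∂(poissonMeasure r) = r := by
  rw [lintegral_countable']
  simp_rw [poissonMeasure_singleton]
  rw [tsum_eq_zero_add' ENNReal.summable]
  have h : ∀ n : ℕ, ((n + 1 : ℕ) : ℝ≥0∞) *
      ENNReal.ofReal (Real.exp (-r) * r ^ (n + 1) / (n + 1).factorial) =
      r * ENNReal.ofReal (Real.exp (-r) * r ^ n / n.factorial) := fun n => by
    rw [← ENNReal.ofReal_natCast, ← ENNReal.ofReal_mul (by positivity),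
      ← ENNReal.ofReal_coe_nnreal, ← ENNReal.ofReal_mul (by positivity), Nat.factorial_succ]
    congr 1
    push_cast
    field_simp
    ring
  simp_rw [h]
  rw [ENNReal.tsum_mul_left, ← ENNReal.ofReal_tsum_of_nonneg (fun n => by positivity)
    (hasSum_one_poissonMeasure r).summable, (hasSum_one_poissonMeasure r).tsum_eq]
  simp

end Poisson

/-! ### Counts, Campbell's formula and the Laplace functional of the Poisson process. -/

section PointProcess

open Filter Topology

variable {Ω : Type*}

theorem toENNReal_pointCount (x : ℕ → Ω → Plane) (B : Set Plane) (ω : Ω) :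
    (pointCount x B ω : ℝ≥0∞) = ∑' k, B.indicator 1 (x k ω) := by
  rw [pointCount, ← ENNReal.tsum_set_one, tsum_subtype {k | x k ω ∈ B} (fun _ => (1 : ℝ≥0∞))]
  rfl

theorem tsum_indicator_const_eq_pointCount_mul (x : ℕ → Ω → Plane) (B : Set Plane) (c : ℝ≥0∞)
    (ω : Ω) : ∑' k, B.indicator (fun _ => c) (x k ω) = pointCount x B ω * c := by
  rw [toENNReal_pointCount, ← ENNReal.tsum_mul_right]
  refine tsum_congr fun k => ?_
  by_cases h : x k ω ∈ B <;> simp [h]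

variable [MeasurableSpace Ω] {P : Measure Ω} {lam : ℝ≥0} {x : ℕ → Ω → Plane}

theorem measurable_pointCount (hx : ∀ k, Measurable (x k)) {B : Set Plane}
    (hB : MeasurableSet B) : Measurable (pointCount x B) := by
  have h : Measurable fun ω => (pointCount x B ω : ℝ≥0∞) := by
    simp_rw [toENNReal_pointCount]
    exact Measurable.tsum fun k => (measurable_one.indicator hB).comp (hx k)
  refine measurable_to_countable' fun n => ?_
  have : pointCount x B ⁻¹' {n} = (fun ω => (pointCount x B ω : ℝ≥0∞)) ⁻¹' {(n : ℝ≥0∞)} := by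
    ext ω
    simp
  rw [this]
  exact h (measurableSet_singleton _)

namespace IsHomogeneousPPP

/-- The probabilities prescribed at the finite values already sum to one, so nothing is left for
`⊤`. -/
theorem ae_pointCount_ne_top [IsProbabilityMeasure P] (hx : IsHomogeneousPPP lam x P)
    {B : Set Plane} (hB : MeasurableSet B) (hvol : volume B ≠ ∞) :
    ∀ᵐ ω ∂P, pointCount x B ω ≠ ⊤ := by
  have hm := measurable_pointCount hx.measurable hB
  have hU : {ω | pointCount x B ω ≠ ⊤} = ⋃ n : ℕ, pointCount x B ⁻¹' {(n : ℕ∞)} := by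
    ext ω
    simp [ENat.ne_top_iff_exists, eq_comm]
  have hmeas : MeasurableSet {ω | pointCount x B ω ≠ ⊤} := by
    rw [hU]
    exact MeasurableSet.iUnion fun n => hm (measurableSet_singleton _)
  refine (mem_ae_iff_prob_eq_one hmeas).2 ?_
  rw [hU, measure_iUnion]
  · have h : ∀ n : ℕ, P (pointCount x B ⁻¹' {(n : ℕ∞)}) =
        poissonMeasure (lam * (volume B).toNNReal) {n} := hx.poisson B hB hvol
    simp_rw [h]
    rw [← measure_iUnion (fun m n hmn => Set.disjoint_singleton.2 hmn)
      fun n => measurableSet_singleton n, Set.iUnion_of_singleton, measure_univ]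
  · exact fun m n hmn => Disjoint.preimage _ (Set.disjoint_singleton.2 (by exact_mod_cast hmn))
  · exact fun n => hm (measurableSet_singleton _)

theorem map_toNat_pointCount [IsProbabilityMeasure P] (hx : IsHomogeneousPPP lam x P)
    {B : Set Plane} (hB : MeasurableSet B) (hvol : volume B ≠ ∞) :
    P.map (fun ω => (pointCount x B ω).toNat) = poissonMeasure (lam * (volume B).toNNReal) := by
  have hm : Measurable fun ω => (pointCount x B ω).toNat :=
    (measurable_of_countable ENat.toNat).comp (measurable_pointCount hx.measurable hB)
  refine Measure.ext_of_singleton fun n => ?_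
  rw [Measure.map_apply hm (measurableSet_singleton n), ← hx.poisson B hB hvol n]
  -- `toNat` sends `⊤` to `0`, which is harmless because `⊤` is taken on a null set only.
  refine measure_congr ?_
  filter_upwards [hx.ae_pointCount_ne_top hB hvol] with ω hω
  obtain ⟨m, hm⟩ := ENat.ne_top_iff_exists.1 hω
  change ((pointCount x B ω).toNat = n) = (pointCount x B ω = n)
  rw [← hm]
  simp

theorem lintegral_pointCount [IsProbabilityMeasure P] (hx : IsHomogeneousPPP lam x P)
    {B : Set Plane} (hB : MeasurableSet B) (hvol : volume B ≠ ∞) :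
    ∫⁻ ω, pointCount x B ω ∂P = lam * volume B := by
  have hm : Measurable fun ω => (pointCount x B ω).toNat :=
    (measurable_of_countable ENat.toNat).comp (measurable_pointCount hx.measurable hB)
  have h := lintegral_natCast_poissonMeasure (lam * (volume B).toNNReal)
  rw [← hx.map_toNat_pointCount hB hvol, lintegral_map (by fun_prop) hm, ENNReal.coe_mul,
    ENNReal.coe_toNNReal hvol] at h
  rw [← h]
  refine lintegral_congr_ae ?_
  filter_upwards [hx.ae_pointCount_ne_top hB hvol] with ω hω
  obtain ⟨m, hm⟩ := ENat.ne_top_iff_exists.1 hω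
  simp [← hm]

/-- The intensity measure of a homogeneous Poisson point process. -/
theorem sum_map_eq [IsProbabilityMeasure P] (hx : IsHomogeneousPPP lam x P) :
    Measure.sum (fun k => P.map (x k)) = (lam : ℝ≥0∞) • volume := by
  have hfin : ∀ B : Set Plane, MeasurableSet B → volume B ≠ ∞ →
      Measure.sum (fun k => P.map (x k)) B = ((lam : ℝ≥0∞) • volume) B := fun B hB hvol => by
    rw [Measure.sum_apply _ hB, Measure.smul_apply, smul_eq_mul, ← hx.lintegral_pointCount hB hvol]
    simp_rw [toENNReal_pointCount]
    rw [lintegral_tsum (f := fun k ω => B.indicator 1 (x k ω)) fun k =>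
      ((measurable_one.indicator hB).comp (hx.measurable k)).aemeasurable]
    refine tsum_congr fun k => ?_
    rw [Measure.map_apply (hx.measurable k) hB, ← lintegral_indicator_one (hx.measurable k hB)]
    rfl
  -- Sets of infinite area are exhausted by their intersections with balls.
  ext B hB
  have hU : B = ⋃ n : ℕ, B ∩ Metric.ball 0 n := by
    rw [← Set.inter_iUnion, Metric.iUnion_ball_nat, Set.inter_univ]
  have hmono : Monotone fun n : ℕ => B ∩ Metric.ball (0 : Plane) n := fun m n hmn =>
    Set.inter_subset_inter_right _ (Metric.ball_subset_ball (by exact_mod_cast hmn))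
  rw [hU, hmono.measure_iUnion, hmono.measure_iUnion]
  refine iSup_congr fun n => hfin _ (hB.inter measurableSet_ball) ?_
  exact ((measure_mono Set.inter_subset_right).trans_lt measure_ball_lt_top).ne

/-- Campbell's formula. -/
theorem lintegral_tsum_comp [IsProbabilityMeasure P] (hx : IsHomogeneousPPP lam x P)
    {g : Plane → ℝ≥0∞} (hg : Measurable g) :
    ∫⁻ ω, ∑' k, g (x k ω) ∂P = lam * ∫⁻ y, g y := by
  rw [lintegral_tsum (f := fun k ω => g (x k ω)) fun k => (hg.comp (hx.measurable k)).aemeasurable]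
  have h := lintegral_sum_measure g fun k => P.map (x k)
  rw [hx.sum_map_eq, lintegral_smul_measure, smul_eq_mul] at h
  rw [h]
  exact tsum_congr fun k => (lintegral_map hg (hx.measurable k)).symm

theorem ae_tsum_comp_ne_top [IsProbabilityMeasure P] (hx : IsHomogeneousPPP lam x P)
    {g : Plane → ℝ≥0∞} (hg : Measurable g) (hfin : ∫⁻ y, g y ≠ ∞) :
    ∀ᵐ ω ∂P, ∑' k, g (x k ω) ≠ ∞ := by
  have h : ∫⁻ ω, ∑' k, g (x k ω) ∂P ≠ ∞ := by
    rw [hx.lintegral_tsum_comp hg]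
    exact ENNReal.mul_ne_top ENNReal.coe_ne_top hfin
  filter_upwards [ae_lt_top (Measurable.tsum fun k => hg.comp (hx.measurable k)) h]
    with ω hω using hω.ne

/-- The Laplace functional for step functions: the sum over the points is `∑ c i * N (B i)`, with
independent Poisson counts `N (B i)`. -/
theorem integral_exp_neg_tsum_sum_indicator [IsProbabilityMeasure P]
    (hx : IsHomogeneousPPP lam x P) {n : ℕ} {B : Fin n → Set Plane}
    (hB : ∀ i, MeasurableSet (B i)) (hdisj : Pairwise fun i j => Disjoint (B i) (B j))
    (hvol : ∀ i, volume (B i) ≠ ∞) (c : Fin n → ℝ≥0) :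
    ∫ ω, Real.exp (-(∑' k, ∑ i, (B i).indicator (fun _ => (c i : ℝ≥0∞)) (x k ω)).toReal) ∂P =
      Real.exp (-lam * ∫ y : Plane,
        (1 - Real.exp (-(∑ i, (B i).indicator (fun _ => (c i : ℝ≥0∞)) y).toReal))) := by
  have h1 : ∀ᵐ ω ∂P,
      Real.exp (-(∑' k, ∑ i, (B i).indicator (fun _ => (c i : ℝ≥0∞)) (x k ω)).toReal) =
        ∏ i, Real.exp (-c i * (pointCount x (B i) ω).toNat) := by
    filter_upwards [ae_all_iff.2 fun i => hx.ae_pointCount_ne_top (hB i) (hvol i)] with ω hω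
    rw [Summable.tsum_finsetSum fun _ _ => ENNReal.summable, ← Real.exp_sum]
    congr 1
    rw [ENNReal.toReal_sum]
    · rw [← Finset.sum_neg_distrib]
      refine Finset.sum_congr rfl fun i _ => ?_
      rw [tsum_indicator_const_eq_pointCount_mul]
      obtain ⟨m, hm⟩ := ENat.ne_top_iff_exists.1 (hω i)
      rw [← hm]
      simp [mul_comm]
    · intro i _
      rw [tsum_indicator_const_eq_pointCount_mul]
      exact ENNReal.mul_ne_top (by simpa using hω i) ENNReal.coe_ne_top
  -- At most one indicator is nonzero at `y`, so `1 - exp (-·)` splits over the pieces.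
  have h2 : ∀ y, 1 - Real.exp (-(∑ i, (B i).indicator (fun _ => (c i : ℝ≥0∞)) y).toReal) =
      ∑ i, (B i).indicator (fun _ => 1 - Real.exp (-c i)) y := fun y => by
    by_cases hy : ∃ j, y ∈ B j
    · obtain ⟨j, hj⟩ := hy
      have hne : ∀ i, i ≠ j → y ∉ B i := fun i hij hi =>
        Set.disjoint_left.1 (hdisj hij) hi hj
      rw [Finset.sum_eq_single j, Finset.sum_eq_single j]
      · simp [hj]
      · intro i _ hij; simp [hne i hij]
      · simp
      · intro i _ hij; simp [hne i hij]
      · simp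
    · push Not at hy
      simp [hy]
  rw [integral_congr_ae h1, (hx.indep n B hB hdisj).integral_fun_prod_comp
    (f := fun i (m : ℕ∞) => Real.exp (-c i * m.toNat))
    (fun i => (measurable_pointCount hx.measurable (hB i)).aemeasurable)
    (fun i => (measurable_of_countable _).aestronglyMeasurable)]
  simp_rw [h2]
  rw [integral_finsetSum _ fun i _ => (integrable_indicator_iff (hB i)).2
    (integrableOn_const (hvol i)), Finset.mul_sum, Real.exp_sum]
  refine Finset.prod_congr rfl fun i _ => ?_
  have hm : Measurable fun ω => (pointCount x (B i) ω).toNat :=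
    (measurable_of_countable ENat.toNat).comp (measurable_pointCount hx.measurable (hB i))
  have h3 := integral_exp_neg_mul_poissonMeasure (lam * (volume (B i)).toNNReal) (c i)
  rw [← hx.map_toNat_pointCount (hB i) (hvol i), integral_map hm.aemeasurable
    (measurable_of_countable _).aestronglyMeasurable] at h3
  rw [h3, integral_indicator_const _ (hB i), smul_eq_mul, measureReal_def]
  congr 1
  push_cast [ENNReal.coe_toNNReal_eq_toReal]
  ring

theorem integral_exp_neg_tsum_simpleFunc [IsProbabilityMeasure P]
    (hx : IsHomogeneousPPP lam x P) (φ : SimpleFunc Plane ℝ≥0∞) (htop : ∀ y, φ y ≠ ∞)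
    (hfin : φ.FinMeasSupp volume) :
    ∫ ω, Real.exp (-(∑' k, φ (x k ω)).toReal) ∂P =
      Real.exp (-lam * ∫ y : Plane, (1 - Real.exp (-(φ y).toReal))) := by
  classical
  -- The value `0` is dropped because its fibre may have infinite area.
  set s : Finset ℝ≥0∞ := φ.range.filter (· ≠ 0) with hs
  let e := s.equivFin.symm
  have hφ : ∀ y, φ y = ∑ i, (φ ⁻¹' {(e i : ℝ≥0∞)}).indicator
      (fun _ => (((e i : ℝ≥0∞).toNNReal : ℝ≥0) : ℝ≥0∞)) y := fun y => by
    rw [Equiv.sum_comp e (fun a : s => (φ ⁻¹' {(a : ℝ≥0∞)}).indicator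
      (fun _ => (((a : ℝ≥0∞).toNNReal : ℝ≥0) : ℝ≥0∞)) y),
      Finset.sum_coe_sort s (fun a => (φ ⁻¹' {a}).indicator
        (fun _ => ((a.toNNReal : ℝ≥0) : ℝ≥0∞)) y)]
    by_cases h0 : φ y = 0
    · rw [h0, eq_comm]
      refine Finset.sum_eq_zero fun a ha => ?_
      have : φ y ≠ a := by
        rw [h0]
        exact (Finset.mem_filter.1 ha).2.symm
      simp [this]
    · rw [Finset.sum_eq_single (φ y)]
      · simp [htop y]
      · intro a _ ha
        simp [ha.symm]
      · intro h
        exact absurd (Finset.mem_filter.2 ⟨φ.mem_range_self y, h0⟩) h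
  have key := hx.integral_exp_neg_tsum_sum_indicator
    (B := fun i => φ ⁻¹' {(e i : ℝ≥0∞)}) (fun i => φ.measurableSet_fiber _)
    (fun i j hij => ?_) (fun i => ?_) (fun i => (e i : ℝ≥0∞).toNNReal)
  · simp_rw [hφ]
    exact key
  · refine Disjoint.preimage _ (Set.disjoint_singleton.2 fun h => hij ?_)
    exact e.injective (Subtype.ext h)
  · exact (hfin.meas_preimage_singleton_ne_zero (Finset.mem_filter.1 (e i).2).2).ne

/-- The Laplace functional of a homogeneous Poisson point process. -/
theorem integral_exp_neg_tsum [IsProbabilityMeasure P] (hx : IsHomogeneousPPP lam x P)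
    {g : Plane → ℝ≥0∞} (hg : Measurable g) (hfin : ∫⁻ y, g y ≠ ∞) :
    ∫ ω, Real.exp (-(∑' k, g (x k ω)).toReal) ∂P =
      Real.exp (-lam * ∫ y : Plane, (1 - Real.exp (-(g y).toReal))) := by
  set φ : ℕ → SimpleFunc Plane ℝ≥0∞ := SimpleFunc.eapprox g
  have hle : ∀ n y, φ n y ≤ g y := fun n y =>
    (le_iSup (fun n => φ n y) n).trans_eq (SimpleFunc.iSup_eapprox_apply hg y)
  have htend : ∀ y, Tendsto (fun n => φ n y) atTop (𝓝 (g y)) := SimpleFunc.tendsto_eapprox hg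
  have htop : ∀ n y, φ n y ≠ ∞ := fun n y => (SimpleFunc.eapprox_lt_top g n y).ne
  have hφ := fun n => hx.integral_exp_neg_tsum_simpleFunc (φ n) (htop n)
    (SimpleFunc.FinMeasSupp.of_lintegral_ne_top (by
      rw [← SimpleFunc.lintegral_eq_lintegral]
      exact ((lintegral_mono (hle n)).trans_lt hfin.lt_top).ne))
  have hgtop : ∀ᵐ y, g y ≠ ∞ := (ae_lt_top hg hfin).mono fun y hy => hy.ne
  -- Monotone convergence for the counting measure on the indices.
  have hsum : ∀ ω, Tendsto (fun n => ∑' k, φ n (x k ω)) atTop (𝓝 (∑' k, g (x k ω))) := fun ω => by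
    simp_rw [← lintegral_count]
    exact lintegral_tendsto_of_tendsto_of_monotone
      (fun n => (measurable_of_countable _).aemeasurable)
      (ae_of_all _ fun k m n hmn => SimpleFunc.monotone_eapprox g hmn _)
      (ae_of_all _ fun k => htend _)
  have hL : Tendsto (fun n => ∫ ω, Real.exp (-(∑' k, φ n (x k ω)).toReal) ∂P) atTop
      (𝓝 (∫ ω, Real.exp (-(∑' k, g (x k ω)).toReal) ∂P)) := by
    refine tendsto_integral_of_dominated_convergence (fun _ => 1) (fun n => ?_)
      (integrable_const _) (fun n => ae_of_all _ fun ω => ?_) ?_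
    · exact (Real.measurable_exp.comp (Measurable.tsum fun k =>
        (φ n).measurable.comp (hx.measurable k)).ennreal_toReal.neg).aestronglyMeasurable
    · rw [Real.norm_of_nonneg (Real.exp_pos _).le, Real.exp_le_one_iff]
      simp
    · filter_upwards [hx.ae_tsum_comp_ne_top hg hfin] with ω hω
      exact (Real.continuous_exp.tendsto _).comp
        ((ENNReal.tendsto_toReal hω).comp (hsum ω)).neg
  have hR : Tendsto (fun n => ∫ y : Plane, (1 - Real.exp (-(φ n y).toReal))) atTop
      (𝓝 (∫ y : Plane, (1 - Real.exp (-(g y).toReal)))) := by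
    -- Domination by `g`: `1 - exp (-t) ≤ t` and `φ n ≤ g`.
    refine tendsto_integral_of_dominated_convergence (fun y => (g y).toReal) (fun n => ?_)
      (integrable_toReal_of_lintegral_ne_top hg.aemeasurable hfin) (fun n => ?_) ?_
    · exact (measurable_const.sub (Real.measurable_exp.comp
        (φ n).measurable.ennreal_toReal.neg)).aestronglyMeasurable
    · filter_upwards [hgtop] with y hy
      have h1 : (φ n y).toReal ≤ (g y).toReal := ENNReal.toReal_mono hy (hle n y)
      have h2 : Real.exp (-(φ n y).toReal) ≤ 1 := by
        rw [Real.exp_le_one_iff]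
        simp
      have h3 := Real.add_one_le_exp (-(φ n y).toReal)
      rw [Real.norm_of_nonneg (by linarith)]
      linarith
    · filter_upwards [hgtop] with y hy
      exact tendsto_const_nhds.sub ((Real.continuous_exp.tendsto _).comp
        ((ENNReal.tendsto_toReal hy).comp (htend y)).neg)
  refine tendsto_nhds_unique (hL.congr hφ) ?_
  exact (Real.continuous_exp.tendsto _).comp (hR.const_mul _)

end IsHomogeneousPPP

end PointProcess

/-! ### Laplace transform and mean of the unit exponential law. -/

section Exponential

theorem integral_expMeasure_one (f : ℝ → ℝ) :
    ∫ t, f t ∂(expMeasure 1) = ∫ t in Set.Ioi (0 : ℝ), Real.exp (-t) * f t := by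
  have h : expMeasure 1 = volume.withDensity (exponentialPDF 1) := rfl
  have hm : Measurable (exponentialPDF 1) := (measurable_exponentialPDFReal 1).ennreal_ofReal
  rw [h, integral_withDensity_eq_integral_toReal_smul hm
    (ae_of_all _ fun _ => ENNReal.ofReal_lt_top),
    ← integral_Ici_eq_integral_Ioi, ← integral_indicator measurableSet_Ici]
  congr 1
  ext t
  rw [exponentialPDF_eq]
  by_cases ht : 0 ≤ t
  · simp [ht, (Real.exp_pos _).le]
  · simp [ht]

theorem integral_exp_neg_mul_expMeasure_one {c : ℝ} (hc : 0 ≤ c) :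
    ∫ t, Real.exp (-c * t) ∂(expMeasure 1) = (1 + c)⁻¹ := by
  have h := Real.integral_rpow_mul_exp_neg_mul_Ioi (a := 1) (r := 1 + c) one_pos (by linarith)
  rw [integral_expMeasure_one]
  simp only [sub_self, Real.rpow_zero, one_mul, Real.rpow_one, Real.Gamma_one, mul_one,
    one_div] at h
  rw [← h]
  congr 1
  ext t
  rw [← Real.exp_add]
  congr 1
  ring

theorem lintegral_ofReal_expMeasure_one_ne_top :
    ∫⁻ t, ENNReal.ofReal t ∂(expMeasure 1) ≠ ∞ := by
  have h := Real.integral_rpow_mul_exp_neg_mul_Ioi (a := 2) (r := 1) two_pos one_pos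
  have h2 : ∫ t, t ∂(expMeasure 1) = 1 := by
    rw [integral_expMeasure_one]
    convert h using 1
    · congr 1
      ext t
      norm_num [mul_comm]
    · norm_num
  -- A non-integrable function would have Bochner integral `0`, but the value is `1`.
  have hi : Integrable (fun t : ℝ => t) (expMeasure 1) := by
    by_contra hn
    rw [integral_undef hn] at h2
    exact zero_ne_one h2
  exact hi.lintegral_lt_top.ne

end Exponential

/-! ### Radial integrals of the bounded path loss. -/

section PathLoss

theorem one_le_pathLoss (r η : ℝ) : 1 ≤ pathLoss r η := le_max_left _ _

theorem pathLoss_pos (r η : ℝ) : 0 < pathLoss r η := one_pos.trans_le (one_le_pathLoss r η)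

theorem measurable_pathLoss (η : ℝ) : Measurable fun r => pathLoss r η := by
  unfold pathLoss
  fun_prop

theorem pathLoss_of_le_one {r η : ℝ} (h0 : 0 ≤ r) (h1 : r ≤ 1) (hη : 0 ≤ η) :
    pathLoss r η = 1 :=
  max_eq_left (Real.rpow_le_one h0 h1 hη)

theorem pathLoss_of_one_le {r η : ℝ} (h1 : 1 ≤ r) (hη : 0 ≤ η) : pathLoss r η = r ^ η :=
  max_eq_right (Real.one_le_rpow h1 hη)

/-- The integrand is `r ^ (1 - η)`, with exponent below `-1` because `η > 2`. -/
theorem integrableOn_Ioi_one_mul_inv_pathLoss {η : ℝ} (hη : 2 < η) :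
    IntegrableOn (fun r => r * (pathLoss r η)⁻¹) (Set.Ioi 1) := by
  refine (integrableOn_Ioi_rpow_of_lt (a := 1 - η) (by linarith) one_pos).congr_fun
    (fun r hr => ?_) measurableSet_Ioi
  have hr : 1 < r := hr
  simp only
  rw [pathLoss_of_one_le hr.le (by linarith), Real.rpow_sub (by linarith), Real.rpow_one,
    div_eq_mul_inv]

theorem integrableOn_mul_inv_pathLoss {η : ℝ} (hη : 2 < η) :
    IntegrableOn (fun r => r * (pathLoss r η)⁻¹) (Set.Ioi 0) := by
  rw [← Set.Ioc_union_Ioi_eq_Ioi (zero_le_one' ℝ)]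
  refine IntegrableOn.union ?_ (integrableOn_Ioi_one_mul_inv_pathLoss hη)
  refine (continuous_id.integrableOn_Ioc (a := 0) (b := 1) (μ := volume)).congr_fun
    (fun r hr => ?_) measurableSet_Ioc
  rw [pathLoss_of_le_one hr.1.le hr.2 (by linarith)]
  simp

theorem integrable_inv_pathLoss_norm {η : ℝ} (hη : 2 < η) :
    Integrable fun y : Plane => (pathLoss ‖y‖ η)⁻¹ := by
  rw [integrable_fun_norm_addHaar volume (f := fun r => (pathLoss r η)⁻¹)]
  simpa using integrableOn_mul_inv_pathLoss hη

theorem div_add_pathLoss_le {a : ℝ} (ha : 0 ≤ a) (r η : ℝ) :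
    a / (a + pathLoss r η) ≤ a * (pathLoss r η)⁻¹ := by
  rw [← div_eq_mul_inv]
  exact div_le_div_of_nonneg_left ha (pathLoss_pos r η) (by linarith)

theorem integrableOn_mul_div_add_pathLoss {a η : ℝ} (ha : 0 ≤ a) (hη : 2 < η) :
    IntegrableOn (fun r => r * (a / (a + pathLoss r η))) (Set.Ioi 0) := by
  refine Integrable.mono' ((integrableOn_mul_inv_pathLoss hη).const_mul a) ?_ ?_
  · exact (measurable_id.mul (measurable_const.div
      (measurable_const.add (measurable_pathLoss η)))).aestronglyMeasurable
  · filter_upwards [ae_restrict_mem measurableSet_Ioi] with r hr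
    have hr : 0 < r := hr
    have := pathLoss_pos r η
    rw [Real.norm_of_nonneg (by positivity), mul_left_comm]
    exact mul_le_mul_of_nonneg_left (div_add_pathLoss_le ha r η) hr.le

/-- Polar coordinates give `2 π ∫ r a / (a + ℓ(r)) dr`; the split at `r = 1`, where `ℓ` changes
form, produces the two terms. -/
theorem integral_div_add_pathLoss_norm {a η : ℝ} (ha : 0 ≤ a) (hη : 2 < η) :
    ∫ y : Plane, a / (a + pathLoss ‖y‖ η) = Real.pi * (a / (1 + a) + functionF a η) := by
  have hball : volume.real (Metric.ball (0 : Plane) 1) = Real.pi := by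
    rw [measureReal_def, EuclideanSpace.volume_ball_fin_two]
    simp [Real.pi_pos.le]
  have hint := integrableOn_mul_div_add_pathLoss ha hη
  rw [← Set.Ioc_union_Ioi_eq_Ioi (zero_le_one' ℝ)] at hint
  have h1 : ∫ r in Set.Ioc (0 : ℝ) 1, r * (a / (a + pathLoss r η)) = a / (1 + a) / 2 := by
    rw [setIntegral_congr_fun measurableSet_Ioc (g := fun r => r * (a / (1 + a)))
      fun r hr => by
        simp only
        rw [pathLoss_of_le_one hr.1.le hr.2 (by linarith), add_comm],
      integral_mul_const, ← intervalIntegral.integral_of_le zero_le_one, integral_id]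
    ring
  have h2 : functionF a η = 2 * ∫ r in Set.Ioi (1 : ℝ), r * (a / (a + pathLoss r η)) := by
    rw [functionF_eq_integral ha hη, ← integral_const_mul]
    refine setIntegral_congr_fun measurableSet_Ioi fun r hr => ?_
    rw [pathLoss_of_one_le (le_of_lt hr) (by linarith), mul_assoc]
  rw [integral_fun_norm_addHaar volume (fun r => a / (a + pathLoss r η)), hball, h2]
  simp only [finrank_euclideanSpace, Fintype.card_fin, nsmul_eq_mul, smul_eq_mul,
    Nat.add_one_sub_one, pow_one]
  rw [← Set.Ioc_union_Ioi_eq_Ioi (zero_le_one' ℝ),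
    setIntegral_union (Set.Ioc_disjoint_Ioi le_rfl) measurableSet_Ioi hint.left_of_union
      hint.right_of_union, h1]
  push_cast
  ring

end PathLoss

/-! ### Averaging over independent Rayleigh fading. -/

section Fading

open Filter Topology

theorem channelGain_nonneg {Ω : Type*} (h : ℕ → Ω → ℂ) (k : ℕ) (ω : Ω) : 0 ≤ channelGain h k ω :=
  sq_nonneg _

variable {Ω : Type*} [MeasurableSpace Ω] {P : Measure Ω}

namespace IsRayleighFading

variable {h : ℕ → Ω → ℂ}

theorem measurable_channelGain (hh : IsRayleighFading h P) (k : ℕ) :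
    Measurable (channelGain h k) :=
  (hh.measurable k).norm.pow_const 2

theorem integral_exp_neg_mul_channelGain (hh : IsRayleighFading h P) (k : ℕ) {c : ℝ}
    (hc : 0 ≤ c) : ∫ ω, Real.exp (-c * channelGain h k ω) ∂P = (1 + c)⁻¹ := by
  rw [← integral_exp_neg_mul_expMeasure_one hc, ← hh.law k,
    integral_map (hh.measurable_channelGain k).aemeasurable (by fun_prop)]

theorem lintegral_channelGain (hh : IsRayleighFading h P) (k : ℕ) :
    ∫⁻ ω, ENNReal.ofReal (channelGain h k ω) ∂P = ∫⁻ t, ENNReal.ofReal t ∂(expMeasure 1) := by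
  rw [← hh.law k, lintegral_map (by fun_prop) (hh.measurable_channelGain k)]

theorem integral_prod_exp_neg_mul_channelGain (hh : IsRayleighFading h P) (N : ℕ)
    {c : Fin N → ℝ} (hc : ∀ k, 0 ≤ c k) :
    ∫ ω, ∏ k, Real.exp (-c k * channelGain h k ω) ∂P = ∏ k, (1 + c k)⁻¹ := by
  have hi : iIndepFun (fun k : Fin N => channelGain h k) P :=
    hh.indep.precomp Fin.val_injective
  rw [hi.integral_fun_prod_comp (f := fun k t => Real.exp (-c k * t))
    (fun k => (hh.measurable_channelGain k).aemeasurable) (fun k => by fun_prop)]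
  exact Finset.prod_congr rfl fun k _ => hh.integral_exp_neg_mul_channelGain k (hc k)

end IsRayleighFading

variable [IsProbabilityMeasure P] {h : ℕ → Ω → ℂ} {x : ℕ → Ω → Plane} {lam : ℝ≥0}

/-- Averaging over the fading of the first `N` links. -/
theorem integral_prod_exp_neg_channelGain_mul (hx : ∀ k, Measurable (x k))
    (hh : IsRayleighFading h P)
    (hxh : IndepFun (fun ω k => channelGain h k ω) (fun ω k => x k ω) P)
    {c : Plane → ℝ} (hc : Measurable c) (hc0 : ∀ y, 0 ≤ c y) (N : ℕ) :
    ∫ ω, ∏ k : Fin N, Real.exp (-c (x k ω) * channelGain h k ω) ∂P =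
      ∫ ω, ∏ k : Fin N, (1 + c (x k ω))⁻¹ ∂P := by
  have hmH : Measurable fun ω k => channelGain h k ω :=
    measurable_pi_lambda _ hh.measurable_channelGain
  have hmX : Measurable fun ω k => x k ω := measurable_pi_lambda _ hx
  have hprod := (indepFun_iff_map_prod_eq_prod_map_map hmH.aemeasurable hmX.aemeasurable).1 hxh
  have := Measure.isProbabilityMeasure_map (μ := P) hmH.aemeasurable
  have := Measure.isProbabilityMeasure_map (μ := P) hmX.aemeasurable
  -- The absolute value keeps `F` bounded by `1` on the whole product space; on actual gains, which
  -- are nonnegative, it changes nothing.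
  set F : (ℕ → ℝ) × (ℕ → Plane) → ℝ := fun p =>
    ∏ k : Fin N, Real.exp (-c (p.2 k) * |p.1 k|) with hF
  have hFm : Measurable F := by fun_prop
  have hFi : Integrable F ((P.map fun ω k => channelGain h k ω).prod (P.map fun ω k => x k ω)) := by
    refine (integrable_const (1 : ℝ)).mono' hFm.aestronglyMeasurable (ae_of_all _ fun p => ?_)
    rw [Real.norm_of_nonneg (Finset.prod_nonneg fun k _ => (Real.exp_pos _).le)]
    refine Finset.prod_le_one (fun k _ => (Real.exp_pos _).le) fun k _ => ?_
    rw [Real.exp_le_one_iff]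
    nlinarith [mul_nonneg (hc0 (p.2 k)) (abs_nonneg (p.1 k))]
  have habs : ∀ k ω, |channelGain h k ω| = channelGain h k ω := fun k ω =>
    abs_of_nonneg (channelGain_nonneg h k ω)
  calc ∫ ω, ∏ k : Fin N, Real.exp (-c (x k ω) * channelGain h k ω) ∂P
      = ∫ ω, F (fun k => channelGain h k ω, fun k => x k ω) ∂P := by
        simp only [hF, habs]
    _ = ∫ p, F p ∂((P.map fun ω k => channelGain h k ω).prod (P.map fun ω k => x k ω)) := by
        rw [← hprod, integral_map (hmH.prodMk hmX).aemeasurable hFm.aestronglyMeasurable]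
    _ = ∫ y, ∏ k : Fin N, (1 + c (y k))⁻¹ ∂(P.map fun ω k => x k ω) := by
        -- Fubini with the fading as inner variable, the locations being frozen.
        rw [integral_prod_symm F hFi]
        congr 1
        ext y
        rw [integral_map (f := fun u => F (u, y)) hmH.aemeasurable
          (hFm.comp measurable_prodMk_right).aestronglyMeasurable]
        simp only [hF, habs]
        exact hh.integral_prod_exp_neg_mul_channelGain N fun k => hc0 (y k)
    _ = ∫ ω, ∏ k : Fin N, (1 + c (x k ω))⁻¹ ∂P := by
        rw [integral_map hmX.aemeasurable]
        exact (by fun_prop : Measurable fun y : ℕ → Plane =>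
          ∏ k : Fin N, (1 + c (y k))⁻¹).aestronglyMeasurable

/-- The expected sum factors, link by link, into the mean gain times `λ ∫ w` by Campbell's formula;
both are finite. -/
theorem ae_summable_channelGain_mul (hx : IsHomogeneousPPP lam x P) (hh : IsRayleighFading h P)
    (hxh : IndepFun (fun ω k => channelGain h k ω) (fun ω k => x k ω) P)
    {w : Plane → ℝ} (hw : Measurable w) (hw0 : ∀ y, 0 ≤ w y) (hwi : Integrable w) :
    ∀ᵐ ω ∂P, Summable fun k => channelGain h k ω * w (x k ω) := by
  have hm : ∀ k, Measurable fun ω => ENNReal.ofReal (channelGain h k ω) *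
      ENNReal.ofReal (w (x k ω)) := fun k =>
    (hh.measurable_channelGain k).ennreal_ofReal.mul (hw.comp (hx.measurable k)).ennreal_ofReal
  have hE : ∫⁻ ω, ∑' k, ENNReal.ofReal (channelGain h k ω) * ENNReal.ofReal (w (x k ω)) ∂P ≠ ∞ := by
    rw [lintegral_tsum fun k => (hm k).aemeasurable]
    have hk : ∀ k, ∫⁻ ω, ENNReal.ofReal (channelGain h k ω) * ENNReal.ofReal (w (x k ω)) ∂P =
        (∫⁻ t, ENNReal.ofReal t ∂(expMeasure 1)) * ∫⁻ ω, ENNReal.ofReal (w (x k ω)) ∂P := fun k => by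
      rw [← hh.lintegral_channelGain k]
      have hi : IndepFun (fun ω => ENNReal.ofReal (channelGain h k ω))
          (fun ω => ENNReal.ofReal (w (x k ω))) P :=
        hxh.comp (φ := fun u : ℕ → ℝ => ENNReal.ofReal (u k))
          (ψ := fun y : ℕ → Plane => ENNReal.ofReal (w (y k))) (by fun_prop) (by fun_prop)
      exact lintegral_mul_eq_lintegral_mul_lintegral_of_indepFun''
        (hh.measurable_channelGain k).ennreal_ofReal.aemeasurable
        (hw.comp (hx.measurable k)).ennreal_ofReal.aemeasurable hi
    simp_rw [hk]
    rw [ENNReal.tsum_mul_left, ← lintegral_tsum (f := fun k ω => ENNReal.ofReal (w (x k ω))) fun k =>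
      (hw.comp (hx.measurable k)).ennreal_ofReal.aemeasurable,
      hx.lintegral_tsum_comp hw.ennreal_ofReal]
    exact ENNReal.mul_ne_top lintegral_ofReal_expMeasure_one_ne_top
      (ENNReal.mul_ne_top ENNReal.coe_ne_top hwi.lintegral_lt_top.ne)
  filter_upwards [ae_lt_top (Measurable.tsum hm) hE] with ω hω
  refine (ENNReal.summable_toReal hω.ne).congr fun k => ?_
  rw [ENNReal.toReal_mul, ENNReal.toReal_ofReal (channelGain_nonneg h k ω),
    ENNReal.toReal_ofReal (hw0 _)]

/-- The Laplace functional of a Poisson process with independent Rayleigh fading. -/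
theorem integral_exp_neg_tsum_channelGain_mul (hx : IsHomogeneousPPP lam x P)
    (hh : IsRayleighFading h P)
    (hxh : IndepFun (fun ω k => channelGain h k ω) (fun ω k => x k ω) P)
    {c : Plane → ℝ} (hc : Measurable c) (hc0 : ∀ y, 0 ≤ c y) (hci : Integrable c) :
    ∫ ω, Real.exp (-∑' k, channelGain h k ω * c (x k ω)) ∂P =
      Real.exp (-lam * ∫ y, c y / (1 + c y)) := by
  -- Chosen so that `exp (-g)` is the fading average `(1 + c)⁻¹`; `log (1 + c) ≤ c` makes it
  -- integrable.
  set g : Plane → ℝ≥0∞ := fun y => ENNReal.ofReal (Real.log (1 + c y)) with hg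
  have hgm : Measurable g := by fun_prop
  have hlog : ∀ y, 0 ≤ Real.log (1 + c y) := fun y => Real.log_nonneg (by linarith [hc0 y])
  have hgfin : ∫⁻ y, g y ≠ ∞ := by
    refine ((lintegral_mono fun y => ?_).trans_lt hci.lintegral_lt_top).ne
    refine ENNReal.ofReal_le_ofReal ?_
    linarith [Real.log_le_sub_one_of_pos (by linarith [hc0 y] : 0 < 1 + c y)]
  have hexp : ∀ y, Real.exp (-(g y).toReal) = (1 + c y)⁻¹ := fun y => by
    rw [hg, ENNReal.toReal_ofReal (hlog y), Real.exp_neg,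
      Real.exp_log (by linarith [hc0 y] : 0 < 1 + c y)]
  have hrhs : ∀ y, 1 - Real.exp (-(g y).toReal) = c y / (1 + c y) := fun y => by
    have : 1 + c y ≠ 0 := by linarith [hc0 y]
    rw [hexp]
    field_simp
    ring
  -- The averaging is done on finitely many links at a time; both sides pass to the limit under the
  -- bound `1`.
  have hL : Tendsto (fun N : ℕ => ∫ ω, ∏ k : Fin N, Real.exp (-c (x k ω) * channelGain h k ω) ∂P)
      atTop (𝓝 (∫ ω, Real.exp (-∑' k, channelGain h k ω * c (x k ω)) ∂P)) := by
    refine tendsto_integral_of_dominated_convergence (fun _ => 1) (fun N => ?_)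
      (integrable_const _) (fun N => ae_of_all _ fun ω => ?_) ?_
    · have h1 := hx.measurable
      have h2 := hh.measurable_channelGain
      exact (by fun_prop : Measurable fun ω =>
        ∏ k : Fin N, Real.exp (-c (x k ω) * channelGain h k ω)).aestronglyMeasurable
    · rw [Real.norm_of_nonneg (Finset.prod_nonneg fun k _ => (Real.exp_pos _).le)]
      refine Finset.prod_le_one (fun k _ => (Real.exp_pos _).le) fun k _ => ?_
      rw [Real.exp_le_one_iff]
      nlinarith [mul_nonneg (hc0 (x k ω)) (channelGain_nonneg h k ω)]
    · filter_upwards [ae_summable_channelGain_mul hx hh hxh hc hc0 hci] with ω hω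
      refine ((Real.continuous_exp.tendsto _).comp hω.hasSum.tendsto_sum_nat.neg).congr fun N => ?_
      rw [← Real.exp_sum, Function.comp_apply, Finset.sum_range, ← Finset.sum_neg_distrib]
      congr 1
      exact Finset.sum_congr rfl fun k _ => by ring
  have hR : Tendsto (fun N : ℕ => ∫ ω, ∏ k : Fin N, (1 + c (x k ω))⁻¹ ∂P)
      atTop (𝓝 (∫ ω, Real.exp (-(∑' k, g (x k ω)).toReal) ∂P)) := by
    refine tendsto_integral_of_dominated_convergence (fun _ => 1) (fun N => ?_)
      (integrable_const _) (fun N => ae_of_all _ fun ω => ?_) ?_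
    · have h1 := hx.measurable
      exact (by fun_prop : Measurable fun ω =>
        ∏ k : Fin N, (1 + c (x k ω))⁻¹).aestronglyMeasurable
    · have hpos : ∀ k, 0 < 1 + c (x k ω) := fun k => by linarith [hc0 (x k ω)]
      rw [Real.norm_of_nonneg (Finset.prod_nonneg fun (k : Fin N) _ =>
        (inv_pos.2 (hpos k)).le)]
      refine Finset.prod_le_one (fun k _ => (inv_pos.2 (hpos k)).le) fun k _ => ?_
      exact inv_le_one_of_one_le₀ (by linarith [hc0 (x k ω)])
    · filter_upwards [hx.ae_tsum_comp_ne_top hgm hgfin] with ω hω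
      rw [ENNReal.tsum_toReal_eq fun k => ENNReal.ofReal_ne_top]
      refine ((Real.continuous_exp.tendsto _).comp
        (ENNReal.hasSum_toReal hω).tendsto_sum_nat.neg).congr fun N => ?_
      rw [Function.comp_apply, Finset.sum_range, ← Finset.sum_neg_distrib, Real.exp_sum]
      exact Finset.prod_congr rfl fun k _ => hexp _
  rw [tendsto_nhds_unique hL (hR.congr fun N =>
    (integral_prod_exp_neg_channelGain_mul hx.measurable hh hxh hc hc0 N).symm),
    hx.integral_exp_neg_tsum hgm hgfin]
  simp_rw [hrhs]

end Fading

/-! ### The Laplace transform of the harvested energy. -/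

theorem lemma2 {Ω : Type*} [MeasurableSpace Ω] (P : Measure Ω) [IsProbabilityMeasure P]
    (lam : ℝ≥0) (hlam : 0 < lam)
    (η : ℝ) (hη : 2 < η)
    (PPB : ℝ) (hPPB : 0 < PPB)
    (mu : ℝ) (hmu0 : 0 < mu) (hmu1 : mu ≤ 1)
    -- the beacon locations and the fading coefficients of their links
    (x : ℕ → Ω → Plane) (hx : IsHomogeneousPPP lam x P)
    (h : ℕ → Ω → ℂ) (hh : IsRayleighFading h P)
    -- the fading is independent of the locations
    (hxh : IndepFun (fun ω k => channelGain h k ω) (fun ω k => x k ω) P) :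
    -- the series that defines `Z` converges almost surely
    (∀ᵐ ω ∂P, Summable (fun k => channelGain h k ω / pathLoss ‖x k ω‖ η)) ∧
    ∀ s : ℝ, 0 ≤ s →
      laplaceTransform (harvestedEnergy PPB mu η x h) P s =
        Real.exp (-Real.pi * lam * (PPB * mu * s / (1 + PPB * mu * s))) *
          Real.exp (-Real.pi * lam * functionF (PPB * mu * s) η) := by
  have hℓ : Measurable fun y : Plane => (pathLoss ‖y‖ η)⁻¹ :=
    ((measurable_pathLoss η).comp measurable_norm).inv
  refine ⟨?_, fun s hs => ?_⟩
  · simpa only [div_eq_mul_inv] using ae_summable_channelGain_mul hx hh hxh hℓ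
      (fun y => (inv_pos.2 (pathLoss_pos _ _)).le) (integrable_inv_pathLoss_norm hη)
  · have ha : 0 ≤ PPB * mu * s := by positivity
    set a : ℝ := PPB * mu * s with ha_def
    have key := integral_exp_neg_tsum_channelGain_mul hx hh hxh
      (c := fun y => a * (pathLoss ‖y‖ η)⁻¹) (hℓ.const_mul a)
      (fun y => mul_nonneg ha (inv_pos.2 (pathLoss_pos _ _)).le)
      ((integrable_inv_pathLoss_norm hη).const_mul a)
    -- This holds for every `ω`: where the series diverges, `tsum` is `0` and both sides vanish.
    have hL : ∀ ω, -s * harvestedEnergy PPB mu η x h ω =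
        -∑' k, channelGain h k ω * (a * (pathLoss ‖x k ω‖ η)⁻¹) := fun ω => by
      rw [harvestedEnergy, neg_mul, ← mul_assoc, ← tsum_mul_left]
      congr 1
      refine tsum_congr fun k => ?_
      rw [ha_def]
      ring
    have hR : ∀ y : Plane, a * (pathLoss ‖y‖ η)⁻¹ / (1 + a * (pathLoss ‖y‖ η)⁻¹) =
        a / (a + pathLoss ‖y‖ η) := fun y => by
      have h1 := pathLoss_pos ‖y‖ η
      field_simp
      ring
    rw [laplaceTransform]
    simp_rw [hL]
    rw [key]
    simp_rw [hR]
    rw [integral_div_add_pathLoss_norm ha hη, ← Real.exp_add]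
    congr 1
    ring
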